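/- Let $M$ be a smooth finite-dimensional manifold with a smooth torsion-free affine connection $\nabla$ such that, for each $x\in M$, the exponential map $\exp_x$ is defined on all of $T_xM$ and maps onto $M$. For a smooth function $f$ let $Hf(X,Y)=X(Df(Y))-Df(\nabla_XY)$ be its Hessian. A set $C\subseteq M$ is convex if every geodesic $\gamma:[a,b]\to M$ with end points in $C$ stays in $C$. Let $C\subseteq M$ be open and convex and let $f:C\to\mathbb R$ be smooth, convex along geodesics, closed (its epigraph $\{(x,y): x\in C,\ y\ge f(x)\}$ is closed in $M\times\mathbb R$), nondegenerate ($Hf_x$ is positive definite for all $x\in C$) and $\sigma$-self-concordant with $\sigma\ge 0$: $$|(\nabla_vHf)(u,u)|\le 2\sigma\,Hf(v,v)^{1/2}\,Hf(u,u)\qquad(x\in C,\ u,v\in T_x).$$ Write $\langle u,v\rangle_{f,x}=Hf_x(u,v)$ and $\|u\|_{f,x}=Hf_x(u,u)^{1/2}$. Let $\nabla^*$ be the dual connection on $C$, given by $\langle Y,\nabla^*_XZ\rangle_f=X\langle Y,Z\rangle_f-\langle\nabla_XY,Z\rangle_f$, that is, $\nabla^*_uZ=Hf_x^{-1}\nabla_u(Hf(Z,\cdot))$.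 Let $\gamma:[0,1]\to C$ be a geodesic of $\nabla$, put $r:=\|\dot\gamma(0)\|_{f,\gamma(0)}$, and assume $\sigma r<1$ (so that $\gamma$ exhibits $\gamma(1)$ as a point of the Dikin ellipsoid of radius $1/\sigma$ at $\gamma(0)$). Let $\tau_{\gamma,t}$ and $\delta_{\gamma,t}:T_{\gamma(0)}\to T_{\gamma(t)}$ be the parallel transports along $\gamma$ for $\nabla$ and $\nabla^*$, respectively. Then: 1. Each eigenvalue $\mu$ of $\delta_{\gamma,1}^{-1}\tau_{\gamma,1}$ satisfies $$(1-\sigma r)^2\le\mu\le\frac1{(1-\sigma r)^2}.$$ Each eigenvalue $\mu'$ of $\int_0^1\delta_{\gamma,t}^{-1}\tau_{\gamma,t}\,dt$ (the integrand being integrable) satisfies $$1-\sigma r+\tfrac13\sigma^2r^2\le\mu'\le\frac1{1-\sigma r}.$$ 2. For every nonzero $v\in T_{\gamma(1)}$, $$1-\sigma r\le\frac{\|v\|_{f,\gamma(1)}}{\|\delta_{\gamma,1}^{-1}v\|_{f,\gamma(0)}}\le\frac1{1-\sigma r}.$$ -/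

import Mathlib

open Set Bundle Manifold
open scoped Manifold ContDiff Topology

noncomputable section

namespace InfoGeom

variable {E : Type*} [NormedAddCommGroup E] [NormedSpace ℝ E]
  {M : Type*} [TopologicalSpace M] [ChartedSpace E M]

/-! ### Curves, parallel vector fields, geodesics -/

/-- The velocity `γ̇(t) ∈ T_{γ(t)} M` of a curve `γ` defined on `s ⊆ ℝ` (one-sided at the end points
of an interval). -/
def velocity (γ : ℝ → M) (s : Set ℝ) (t : ℝ) : TangentSpace 𝓘(ℝ, E) (γ t) :=
  mfderivWithin 𝓘(ℝ, ℝ) 𝓘(ℝ, E) γ s t (1 : ℝ)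

variable [IsManifold 𝓘(ℝ, E) ∞ M]

/-- A vector field `V` along `γ`, read in the local trivialization of the tangent bundle at the
point `γ t₀`: a curve in the model space, defined for parameters near `t₀`. -/
def localCoord (γ : ℝ → M) (V : ∀ t, TangentSpace 𝓘(ℝ, E) (γ t)) (t₀ : ℝ) : ℝ → E :=
  fun t ↦ (trivializationAt E (TangentSpace 𝓘(ℝ, E) : M → Type _) (γ t₀)).continuousLinearMapAt ℝ
    (γ t) (V t)

/-- The covariant derivative along `γ` at `t` of a vector field `V` along `γ`, for a covariant
derivative operator `cov` (`cov Y x u` is `∇_u Y`). If `V = ∑ cᵢ sᵢ` in the constant local frame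
`(sᵢ)` of the trivialization at `γ t`, this is `∑ cᵢ' sᵢ + ∑ cᵢ ∇_{γ̇} sᵢ`; the section
`FiberBundle.extend E (V t)` is `∑ cᵢ(t) sᵢ`. -/
def covDerivAlong
    (cov : (Π x : M, TangentSpace 𝓘(ℝ, E) x) →
      (Π x : M, TangentSpace 𝓘(ℝ, E) x →L[ℝ] TangentSpace 𝓘(ℝ, E) x))
    (γ : ℝ → M) (s : Set ℝ) (V : ∀ t, TangentSpace 𝓘(ℝ, E) (γ t)) (t : ℝ) :
    TangentSpace 𝓘(ℝ, E) (γ t) :=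
  (trivializationAt E (TangentSpace 𝓘(ℝ, E) : M → Type _) (γ t)).symmL ℝ (γ t)
      (derivWithin (localCoord γ V t) s t)
    + cov (FiberBundle.extend E (V t)) (γ t) (velocity γ s t)

/-- `V` is differentiable and parallel along `γ` on `s`. -/
def IsParallelAlong
    (cov : (Π x : M, TangentSpace 𝓘(ℝ, E) x) →
      (Π x : M, TangentSpace 𝓘(ℝ, E) x →L[ℝ] TangentSpace 𝓘(ℝ, E) x))
    (γ : ℝ → M) (s : Set ℝ) (V : ∀ t, TangentSpace 𝓘(ℝ, E) (γ t)) : Prop :=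
  ∀ t ∈ s, DifferentiableWithinAt ℝ (localCoord γ V t) s t ∧ covDerivAlong cov γ s V t = 0

/-- `τ t : T_{γ(0)} → T_{γ(t)}`, for `t ∈ [0,1]`, is the parallel transport along `γ : [0,1] → M`:
for each `u ∈ T_{γ(0)}` the field `t ↦ τ t u` is parallel along `γ` and starts at `u`.
(By uniqueness for linear ODEs this determines `τ t` for `t ∈ [0,1]`.) -/
structure IsParallelTransport
    (cov : (Π x : M, TangentSpace 𝓘(ℝ, E) x) →
      (Π x : M, TangentSpace 𝓘(ℝ, E) x →L[ℝ] TangentSpace 𝓘(ℝ, E) x))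
    (γ : ℝ → M)
    (τ : ∀ t : ℝ, TangentSpace 𝓘(ℝ, E) (γ 0) ≃L[ℝ] TangentSpace 𝓘(ℝ, E) (γ t)) : Prop where
  map_zero : ∀ u, τ 0 u = u
  parallel : ∀ u, IsParallelAlong cov γ (Icc 0 1) (fun t ↦ τ t u)

/-- `γ : [a,b] → M` is a (smooth) geodesic: its velocity is parallel along it. -/
structure IsGeodesic (nabla : CovariantDerivative 𝓘(ℝ, E) E (TangentSpace 𝓘(ℝ, E) : M → Type _))
    (γ : ℝ → M) (a b : ℝ) : Prop where
  smooth : ContMDiffOn 𝓘(ℝ, ℝ) 𝓘(ℝ, E) ∞ γ (Icc a b)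
  parallel : IsParallelAlong nabla γ (Icc a b) (velocity γ (Icc a b))

/-- The connection is torsion-free. -/
def IsTorsionFree [FiniteDimensional ℝ E]
    (nabla : CovariantDerivative 𝓘(ℝ, E) E (TangentSpace 𝓘(ℝ, E) : M → Type _)) : Prop :=
  haveI : CompleteSpace E := FiniteDimensional.complete ℝ E
  nabla.torsion = 0

/-- For each `x`, the exponential map `exp_x u = γ(1)`, where `γ` is the geodesic with `γ(0) = x` and
`γ̇(0) = u`, is defined on all of `T_x M` and maps onto `M`. -/
structure HasSurjectiveExp
    (nabla : CovariantDerivative 𝓘(ℝ, E) E (TangentSpace 𝓘(ℝ, E) : M → Type _)) : Prop where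
  defined : ∀ (x : M) (u : TangentSpace 𝓘(ℝ, E) x), ∃ γ : ℝ → M, IsGeodesic nabla γ 0 1 ∧
    (⟨γ 0, velocity γ (Icc 0 1) 0⟩ : TangentBundle 𝓘(ℝ, E) M) = ⟨x, u⟩
  surjective : ∀ x y : M, ∃ γ : ℝ → M, IsGeodesic nabla γ 0 1 ∧ γ 0 = x ∧ γ 1 = y

/-! ### Covariant derivatives of covariant tensor fields, the Hessian -/

/-- `(∇_u α)(v) = u(α(Y)) - α(∇_u Y)` for a `(0,1)`-tensor field `α`, `u, v ∈ T_x`, where `Y` is a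
local vector field with `Y_x = v`. -/
def covDeriv₁ (nabla : CovariantDerivative 𝓘(ℝ, E) E (TangentSpace 𝓘(ℝ, E) : M → Type _))
    (α : ∀ x : M, TangentSpace 𝓘(ℝ, E) x → ℝ) (x : M) (u v : TangentSpace 𝓘(ℝ, E) x) : ℝ :=
  mvfderiv 𝓘(ℝ, E) (fun y ↦ α y (FiberBundle.extend E v y)) x u
    - α x (nabla (FiberBundle.extend E v) x u)

/-- `(∇_w G)(u,v) = w(G(Y,Z)) - G(∇_w Y, v) - G(u, ∇_w Z)` for a `(0,2)`-tensor field `G`,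
`u, v, w ∈ T_x`, where `Y, Z` are local vector fields with `Y_x = u`, `Z_x = v`. -/
def covDeriv₂ (nabla : CovariantDerivative 𝓘(ℝ, E) E (TangentSpace 𝓘(ℝ, E) : M → Type _))
    (G : ∀ x : M, TangentSpace 𝓘(ℝ, E) x → TangentSpace 𝓘(ℝ, E) x → ℝ) (x : M)
    (w u v : TangentSpace 𝓘(ℝ, E) x) : ℝ :=
  mvfderiv 𝓘(ℝ, E) (fun y ↦ G y (FiberBundle.extend E u y) (FiberBundle.extend E v y)) x w
    - G x (nabla (FiberBundle.extend E u) x w) v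
    - G x u (nabla (FiberBundle.extend E v) x w)

/-- The Hessian `Hf_x(u,v) = (∇_u Df)(v)`. -/
def hess (nabla : CovariantDerivative 𝓘(ℝ, E) E (TangentSpace 𝓘(ℝ, E) : M → Type _))
    (f : M → ℝ) (x : M) (u v : TangentSpace 𝓘(ℝ, E) x) : ℝ :=
  covDeriv₁ nabla (fun y w ↦ mvfderiv 𝓘(ℝ, E) f y w) x u v

/-- The local norm `‖u‖_{f,x} = Hf_x(u,u)^{1/2}`. -/
def localNorm (nabla : CovariantDerivative 𝓘(ℝ, E) E (TangentSpace 𝓘(ℝ, E) : M → Type _))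
    (f : M → ℝ) (x : M) (u : TangentSpace 𝓘(ℝ, E) x) : ℝ :=
  Real.sqrt (hess nabla f x u u)

/-! ### Self-concordant functions -/

/-- Every geodesic with end points in `C` stays in `C`. -/
def GeodesicallyConvex
    (nabla : CovariantDerivative 𝓘(ℝ, E) E (TangentSpace 𝓘(ℝ, E) : M → Type _))
    (C : Set M) : Prop :=
  ∀ (γ : ℝ → M) (a b : ℝ), a ≤ b → IsGeodesic nabla γ a b → γ a ∈ C → γ b ∈ C →
    ∀ t ∈ Icc a b, γ t ∈ C

/-- `f : C → ℝ` (the values of `f` outside `C` are irrelevant) is a closed nondegenerate convex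
function on the open convex set `C` that is `σ`-self-concordant. -/
structure IsSelfConcordant
    (nabla : CovariantDerivative 𝓘(ℝ, E) E (TangentSpace 𝓘(ℝ, E) : M → Type _))
    (C : Set M) (f : M → ℝ) (σ : ℝ) : Prop where
  isOpen : IsOpen C
  convex_set : GeodesicallyConvex nabla C
  smooth : ContMDiffOn 𝓘(ℝ, E) 𝓘(ℝ, ℝ) ∞ f C
  convex : ∀ (γ : ℝ → M) (a b : ℝ), IsGeodesic nabla γ a b → (∀ t ∈ Icc a b, γ t ∈ C) →
    ConvexOn ℝ (Icc a b) (f ∘ γ)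
  closed : IsClosed {p : M × ℝ | p.1 ∈ C ∧ f p.1 ≤ p.2}
  nondegenerate : ∀ x ∈ C, ∀ u : TangentSpace 𝓘(ℝ, E) x, u ≠ 0 → 0 < hess nabla f x u u
  nonneg : 0 ≤ σ
  bound : ∀ x ∈ C, ∀ u v : TangentSpace 𝓘(ℝ, E) x,
    |covDeriv₂ nabla (hess nabla f) x v u u|
      ≤ 2 * σ * Real.sqrt (hess nabla f x v v) * hess nabla f x u u

/-! ### The dual connection -/

open Classical in
/-- The dual connection `∇*` of `∇` with respect to the metric `⟨,⟩_f = Hf`: for a vector field `Z`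
differentiable at a point `x` where `Hf_x` is nondegenerate, `∇*_u Z ∈ T_x` is the vector with
`Hf_x(∇*_u Z, v) = u(Hf(Z, Y)) - Hf_x(Z_x, ∇_u Y)` for `v = Y_x`, i.e.
`∇*_u Z = Hf_x⁻¹ (∇_u (Hf(Z, ·)))`. (The value `0` is used where no such linear map exists.) -/
def dualConnection (nabla : CovariantDerivative 𝓘(ℝ, E) E (TangentSpace 𝓘(ℝ, E) : M → Type _))
    (f : M → ℝ) (Z : Π x : M, TangentSpace 𝓘(ℝ, E) x) (x : M) :
    TangentSpace 𝓘(ℝ, E) x →L[ℝ] TangentSpace 𝓘(ℝ, E) x :=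
  if h : ∃ L : TangentSpace 𝓘(ℝ, E) x →L[ℝ] TangentSpace 𝓘(ℝ, E) x,
      ∀ u v, hess nabla f x (L u) v = covDeriv₁ nabla (fun y w ↦ hess nabla f y (Z y) w) x u v
  then h.choose else 0

/-! ### The return transport -/

/-- `δ_{γ,t}⁻¹ τ_{γ,t} : T_{γ(0)} → T_{γ(0)}`. -/
def returnTransport {γ : ℝ → M}
    (τ δ : ∀ t : ℝ, TangentSpace 𝓘(ℝ, E) (γ 0) ≃L[ℝ] TangentSpace 𝓘(ℝ, E) (γ t)) (t : ℝ) :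
    TangentSpace 𝓘(ℝ, E) (γ 0) →L[ℝ] TangentSpace 𝓘(ℝ, E) (γ 0) :=
  ((τ t).trans (δ t).symm : TangentSpace 𝓘(ℝ, E) (γ 0) →L[ℝ] TangentSpace 𝓘(ℝ, E) (γ 0))

/-- A curve of endomorphisms of `T_x`, viewed in the normed space `E →L[ℝ] E` (the type
`TangentSpace 𝓘(ℝ, E) x` is `E` by definition, without the norm). -/
def endCurve {x : M} (A : ℝ → (TangentSpace 𝓘(ℝ, E) x →L[ℝ] TangentSpace 𝓘(ℝ, E) x)) :
    ℝ → (E →L[ℝ] E) :=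
  A

/-- `∫₀¹ A(t) dt ∈ End(T_x)`. -/
def endIntegral {x : M} (A : ℝ → (TangentSpace 𝓘(ℝ, E) x →L[ℝ] TangentSpace 𝓘(ℝ, E) x)) :
    TangentSpace 𝓘(ℝ, E) x →L[ℝ] TangentSpace 𝓘(ℝ, E) x :=
  (∫ t in (0 : ℝ)..1, endCurve A t : E →L[ℝ] E)

end InfoGeom

end

/-! Along `γ`, the defining equation of `∇*` says that the Hessian pairing of a `∇*`-parallel field
with a `∇`-parallel field is constant. Hence `⟨δ_t⁻¹ τ_t u, v⟩₀ = ⟨τ_t u, τ_t v⟩_t`: the return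
transport represents, in the metric at `γ 0`, the metric at `γ t` pulled back by `τ_t`. Its
eigenvalues are therefore values of the quotient `‖τ_t v‖²_t / ‖v‖²₀`.

This quotient is controlled by a differential inequality. For a `∇`-parallel field `V`, the
derivative of `φ = Hf(V, V)` is `(∇_γ̇ Hf)(V, V)`, so self-concordance gives `|φ'| ≤ 2σ w φ` with `w
= ‖γ̇‖`. The velocity is itself parallel, and `V = γ̇` gives formally `w' ≤ σ w²`, hence `w(t) ≤ r /
(1 - σrt)`. Inserting this for general `V` bounds `φ(t) / φ(0)` between `(1 - σrt)²` and its
inverse. Taking `t = 1` gives the eigenvalues of the return transport; integrating over `t` gives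
those of its mean.

The norm estimate for `δ` follows from that for `τ` by duality: constancy of the mixed pairing and
Cauchy–Schwarz. Only Cauchy–Schwarz needs the symmetry of the Hessian, which comes from vanishing
torsion.

The carrying lemmas are `hasDerivWithinAt_hess_parallel`, `IsGeodesic.hess_dual_transport` and
`IsGeodesic.hess_comparison`. -/

namespace InfoGeom

/-! ### Local extensions of tangent vectors -/

section Extension

variable {E : Type*} [NormedAddCommGroup E] [NormedSpace ℝ E]
  {M : Type*} [TopologicalSpace M] [ChartedSpace E M] [IsManifold 𝓘(ℝ, E) ∞ M]

/-- Near `x` the extension has constant coefficients in the trivialization at `x`; linearity in `v`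
and the coordinate computations below rest on this. -/
theorem extend_eq_symmL {x : M} (v : TangentSpace 𝓘(ℝ, E) x) {y : M}
    (hy : y ∈ (trivializationAt E (TangentSpace 𝓘(ℝ, E) : M → Type _) x).baseSet) :
    FiberBundle.extend E v y =
      (trivializationAt E (TangentSpace 𝓘(ℝ, E) : M → Type _) x).symmL ℝ y
        ((trivializationAt E (TangentSpace 𝓘(ℝ, E) : M → Type _) x).continuousLinearMapAt ℝ x v) := by
  have hx := FiberBundle.mem_baseSet_trivializationAt' (F := E)
    (E := (TangentSpace 𝓘(ℝ, E) : M → Type _)) x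
  rw [Trivialization.continuousLinearMapAt_apply, Trivialization.coe_linearMapAt_of_mem _ hx,
    Trivialization.symmL_apply _ hy]
  simp [FiberBundle.extend]

theorem eventually_mem_baseSet (x : M) :
    ∀ᶠ y in 𝓝 x, y ∈ (trivializationAt E (TangentSpace 𝓘(ℝ, E) : M → Type _) x).baseSet :=
  (trivializationAt E (TangentSpace 𝓘(ℝ, E) : M → Type _) x).open_baseSet.mem_nhds
    (FiberBundle.mem_baseSet_trivializationAt' x)

theorem extend_add_eventuallyEq {x : M} (v w : TangentSpace 𝓘(ℝ, E) x) :
    ∀ᶠ y in 𝓝 x, FiberBundle.extend E (v + w) y =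
      FiberBundle.extend E v y + FiberBundle.extend E w y := by
  filter_upwards [eventually_mem_baseSet (E := E) x] with y hy
  simp [extend_eq_symmL _ hy]

theorem extend_smul_eventuallyEq {x : M} (c : ℝ) (v : TangentSpace 𝓘(ℝ, E) x) :
    ∀ᶠ y in 𝓝 x, FiberBundle.extend E (c • v) y = c • FiberBundle.extend E v y := by
  filter_upwards [eventually_mem_baseSet (E := E) x] with y hy
  simp [extend_eq_symmL _ hy]

theorem eventually_contMDiffAt_extend {x : M} (v : TangentSpace 𝓘(ℝ, E) x) :
    ∀ᶠ y in 𝓝 x, ContMDiffAt 𝓘(ℝ, E) (𝓘(ℝ, E).prod 𝓘(ℝ, E)) ∞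
      (fun z ↦ (⟨z, FiberBundle.extend E v z⟩ : TangentBundle 𝓘(ℝ, E) M)) y := by
  obtain ⟨s, hs, h⟩ := FiberBundle.exists_contMDiffOn_extend (k := ∞) 𝓘(ℝ, E) E v
  filter_upwards [eventually_mem_nhds_iff.2 hs] with y hy
  exact h.contMDiffAt hy

end Extension

theorem mvfderiv_congr {E : Type*} [NormedAddCommGroup E] [NormedSpace ℝ E]
    {M : Type*} [TopologicalSpace M] [ChartedSpace E M] {g g' : M → ℝ} {x : M}
    (h : g =ᶠ[𝓝 x] g') : mvfderiv 𝓘(ℝ, E) g x = mvfderiv 𝓘(ℝ, E) g' x :=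
  h.mfderiv_eq (I := 𝓘(ℝ, E)) (I' := 𝓘(ℝ, ℝ))

/-! ### The Hessian as a smooth tensor -/

section Hessian

variable {E : Type*} [NormedAddCommGroup E] [NormedSpace ℝ E]
  {M : Type*} [TopologicalSpace M] [ChartedSpace E M] [IsManifold 𝓘(ℝ, E) ∞ M]

theorem contMDiffAt_mvfderiv_apply {f : M → ℝ} {V : Π x : M, TangentSpace 𝓘(ℝ, E) x} {x : M}
    (hf : ContMDiffAt 𝓘(ℝ, E) 𝓘(ℝ, ℝ) ∞ f x)
    (hV : ContMDiffAt 𝓘(ℝ, E) (𝓘(ℝ, E).prod 𝓘(ℝ, E)) ∞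
      (fun y ↦ (⟨y, V y⟩ : TangentBundle 𝓘(ℝ, E) M)) x) :
    ContMDiffAt 𝓘(ℝ, E) 𝓘(ℝ, ℝ) ∞ (fun y ↦ mvfderiv 𝓘(ℝ, E) f y (V y)) x := by
  have h1 := hf.mfderiv_const (m := ∞) (by simp)
  have h2 := ContMDiffAt.clm_apply_of_inCoordinates (b₁ := id) (b₂ := f)
    (ϕ := fun y ↦ mfderiv 𝓘(ℝ, E) 𝓘(ℝ, ℝ) f y) h1 hV hf
  exact (contMDiff_snd_tangentBundle_modelSpace ℝ 𝓘(ℝ, ℝ)).contMDiffAt.comp x h2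

theorem mdifferentiableAt_mvfderiv_apply {f : M → ℝ} {V : Π x : M, TangentSpace 𝓘(ℝ, E) x} {x : M}
    (hf : ContMDiffAt 𝓘(ℝ, E) 𝓘(ℝ, ℝ) ∞ f x)
    (hV : MDifferentiableAt 𝓘(ℝ, E) (𝓘(ℝ, E).prod 𝓘(ℝ, E))
      (fun y ↦ (⟨y, V y⟩ : TangentBundle 𝓘(ℝ, E) M)) x) :
    MDifferentiableAt 𝓘(ℝ, E) 𝓘(ℝ, ℝ) (fun y ↦ mvfderiv 𝓘(ℝ, E) f y (V y)) x := by
  have h1 := (hf.mfderiv_const (m := ∞) (by simp)).mdifferentiableAt (by simp)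
  have h2 := MDifferentiableAt.clm_apply_of_inCoordinates (b₁ := id) (b₂ := f)
    (ϕ := fun y ↦ mfderiv 𝓘(ℝ, E) 𝓘(ℝ, ℝ) f y) h1 hV (hf.mdifferentiableAt (by simp))
  exact ((contMDiff_snd_tangentBundle_modelSpace (n := 1) ℝ 𝓘(ℝ, ℝ)).mdifferentiable
    (by simp)).mdifferentiableAt.comp x h2

variable (nabla : CovariantDerivative 𝓘(ℝ, E) E (TangentSpace 𝓘(ℝ, E) : M → Type _))

/-- Replacing `V` by `g • V` produces the term `u(g) Df(V)` in both summands, and the two cancel. -/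
theorem hess_tensorialAt {f : M → ℝ} {x : M}
    (hf : ContMDiffAt 𝓘(ℝ, E) 𝓘(ℝ, ℝ) ∞ f x) (u : TangentSpace 𝓘(ℝ, E) x) :
    TensorialAt 𝓘(ℝ, E) E (fun V : Π x : M, TangentSpace 𝓘(ℝ, E) x ↦
      mvfderiv 𝓘(ℝ, E) (fun y ↦ mvfderiv 𝓘(ℝ, E) f y (V y)) x u
        - mvfderiv 𝓘(ℝ, E) f x (nabla V x u)) x where
  smul {g σ} hg hσ := by
    have h1 := mvfderiv_mul hg (mdifferentiableAt_mvfderiv_apply hf hσ)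
    have h2 : (fun y ↦ mvfderiv 𝓘(ℝ, E) f y ((g • σ) y)) =
      g * (fun y ↦ mvfderiv 𝓘(ℝ, E) f y (σ y)) := by funext y; simp
    have h3 := nabla.isCovariantDerivativeOnUniv.leibniz hσ hg
    simp only [h2, h1, h3]
    simp
    ring
  add {σ σ'} hσ hσ' := by
    have h1 := mvfderiv_add (mdifferentiableAt_mvfderiv_apply hf hσ)
      (mdifferentiableAt_mvfderiv_apply hf hσ')
    have h2 : (fun y ↦ mvfderiv 𝓘(ℝ, E) f y ((σ + σ') y)) =
      (fun y ↦ mvfderiv 𝓘(ℝ, E) f y (σ y)) + (fun y ↦ mvfderiv 𝓘(ℝ, E) f y (σ' y)) := by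
      funext y; simp
    have h3 := nabla.isCovariantDerivativeOnUniv.add hσ hσ'
    simp only [h2, h1, h3]
    simp
    ring

variable [FiniteDimensional ℝ E]

/-- Tensoriality frees `hess` from the extension in its definition, which changes with the base
point. A single section then computes it at all nearby points, as differentiating it requires. -/
theorem hess_eq_of_section {f : M → ℝ} {x : M} {V : Π x : M, TangentSpace 𝓘(ℝ, E) x}
    (hf : ContMDiffAt 𝓘(ℝ, E) 𝓘(ℝ, ℝ) ∞ f x)
    (hV : MDifferentiableAt 𝓘(ℝ, E) (𝓘(ℝ, E).prod 𝓘(ℝ, E))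
      (fun y ↦ (⟨y, V y⟩ : TangentBundle 𝓘(ℝ, E) M)) x)
    (u : TangentSpace 𝓘(ℝ, E) x) :
    hess nabla f x u (V x) = mvfderiv 𝓘(ℝ, E) (fun y ↦ mvfderiv 𝓘(ℝ, E) f y (V y)) x u
        - mvfderiv 𝓘(ℝ, E) f x (nabla V x u) := by
  rw [← (hess_tensorialAt nabla hf u).pointwise (FiberBundle.mdifferentiableAt_extend _ _ (V x)) hV
    (by simp)]
  simp [hess, covDeriv₁]

/-- The Hessian at a point where the function is smooth, as a bilinear map. -/
noncomputable def hessBilin {f : M → ℝ} {x : M} (hf : ContMDiffAt 𝓘(ℝ, E) 𝓘(ℝ, ℝ) ∞ f x) :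
    TangentSpace 𝓘(ℝ, E) x →ₗ[ℝ] TangentSpace 𝓘(ℝ, E) x →ₗ[ℝ] ℝ :=
  LinearMap.mk₂ ℝ (hess nabla f x)
    (fun u u' v ↦ by simp [hess, covDeriv₁]; ring)
    (fun c u v ↦ by simp [hess, covDeriv₁]; ring)
    (fun u v v' ↦ (TensorialAt.mkHom _ _ (hess_tensorialAt nabla hf u)).map_add v v')
    (fun c u v ↦ (TensorialAt.mkHom _ _ (hess_tensorialAt nabla hf u)).map_smul c v)

theorem hessBilin_apply {f : M → ℝ} {x : M} (hf : ContMDiffAt 𝓘(ℝ, E) 𝓘(ℝ, ℝ) ∞ f x)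
    (u v : TangentSpace 𝓘(ℝ, E) x) : hessBilin nabla hf u v = hess nabla f x u v := rfl

variable [T2Space M] [CovariantDerivative.ContMDiffCovariantDerivative nabla ∞]

/-- Smoothness of `∇` is applied to a globally smooth section, so the extension is first cut off by
a bump function; `∇` is local, so nothing changes near `x`. -/
theorem contMDiffAt_nabla_extend {x : M} (v : TangentSpace 𝓘(ℝ, E) x) :
    ContMDiffAt 𝓘(ℝ, E) (𝓘(ℝ, E).prod 𝓘(ℝ, E →L[ℝ] E)) ∞
      (fun y ↦ (⟨y, nabla (FiberBundle.extend E v) y⟩ : TotalSpace (E →L[ℝ] E)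
        (fun y : M ↦ TangentSpace 𝓘(ℝ, E) y →L[ℝ] TangentSpace 𝓘(ℝ, E) y))) x := by
  obtain ⟨s, hs, hsm⟩ := FiberBundle.exists_contMDiffOn_extend (k := ∞) 𝓘(ℝ, E) E v
  obtain ⟨u, hus, huo, hxu⟩ := mem_nhds_iff.1 hs
  obtain ⟨ψ, -, hψ⟩ := (SmoothBumpFunction.nhds_basis_tsupport (I := 𝓘(ℝ, E)) x).mem_iff.1
    (huo.mem_nhds hxu)
  have hglob := ContMDiffOn.smul_section_of_tsupport (ψ.contMDiff.contMDiffOn (s := u)) huo hψ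
    (hsm.mono hus)
  have hcov := (CovariantDerivative.ContMDiffCovariantDerivative.contMDiff
    (cov := nabla) (k := ∞)).contMDiff (σ := (ψ : M → ℝ) • FiberBundle.extend E v)
    (by simpa using hglob.contMDiffOn)
  refine (hcov.contMDiffAt Filter.univ_mem).congr_of_eventuallyEq ?_
  -- The value of `∇` at `y` depends on the germ there, so the bump must equal one on a
  -- neighbourhood of each nearby `y`.
  have he := ψ.eventuallyEq_one.eventually_nhds
  filter_upwards [he, huo.mem_nhds hxu] with y hy hyu
  congr 1
  refine (nabla.isCovariantDerivativeOnUniv.congr_of_eventuallyEq ?_ ?_ Filter.univ_mem ?_).symm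
  · exact hglob.contMDiffAt.mdifferentiableAt (by simp)
  · exact ((hsm.mono hus).contMDiffAt (huo.mem_nhds hyu)).mdifferentiableAt (by simp)
  · filter_upwards [hy] with z hz
    simp [hz]

theorem contMDiffAt_hess_extend {f : M → ℝ} {x : M}
    (hf : ∀ᶠ y in 𝓝 x, ContMDiffAt 𝓘(ℝ, E) 𝓘(ℝ, ℝ) ∞ f y) (u v : TangentSpace 𝓘(ℝ, E) x) :
    ContMDiffAt 𝓘(ℝ, E) 𝓘(ℝ, ℝ) ∞
      (fun y ↦ hess nabla f y (FiberBundle.extend E u y) (FiberBundle.extend E v y)) x := by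
  have hu := (eventually_contMDiffAt_extend u).self_of_nhds
  have hv := (eventually_contMDiffAt_extend v).self_of_nhds
  have h1 := contMDiffAt_mvfderiv_apply (contMDiffAt_mvfderiv_apply hf.self_of_nhds hv) hu
  have h2 := contMDiffAt_mvfderiv_apply hf.self_of_nhds
    ((contMDiffAt_nabla_extend nabla v).clm_bundle_apply hu)
  refine (h1.sub h2).congr_of_eventuallyEq ?_
  filter_upwards [hf, eventually_contMDiffAt_extend v] with y hy hvy
  exact hess_eq_of_section nabla hy (hvy.mdifferentiableAt (by simp)) _

end Hessian

/-! ### Symmetry of the Hessian of a torsion-free connection -/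

section Symmetry

variable {E : Type*} [NormedAddCommGroup E] [NormedSpace ℝ E]
  {M : Type*} [TopologicalSpace M] [ChartedSpace E M] [IsManifold 𝓘(ℝ, E) ∞ M]

/-- In the chart at `x` both extensions are constant vector fields. -/
theorem mlieBracket_extend {x : M} (u v : TangentSpace 𝓘(ℝ, E) x) :
    VectorField.mlieBracket 𝓘(ℝ, E) (FiberBundle.extend E u) (FiberBundle.extend E v) x = 0 := by
  have key : ∀ w : TangentSpace 𝓘(ℝ, E) x,
      VectorField.mpullbackWithin 𝓘(ℝ, E) 𝓘(ℝ, E) (extChartAt 𝓘(ℝ, E) x).symm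
        (FiberBundle.extend E w) (range 𝓘(ℝ, E)) =ᶠ[𝓝 (extChartAt 𝓘(ℝ, E) x x)]
      fun _ ↦ (trivializationAt E (TangentSpace 𝓘(ℝ, E) : M → Type _) x).continuousLinearMapAt
        ℝ x w := by
    intro w
    filter_upwards [extChartAt_target_mem_nhds (I := 𝓘(ℝ, E)) x] with z hz
    have hy : (extChartAt 𝓘(ℝ, E) x).symm z ∈ (chartAt E x).source := by
      simpa using (extChartAt 𝓘(ℝ, E) x).map_target hz
    rw [VectorField.mpullbackWithin_apply, extend_eq_symmL _ (by simpa using hy),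
      TangentBundle.symmL_trivializationAt hy, (extChartAt 𝓘(ℝ, E) x).right_inv hz]
    exact (isInvertible_mfderivWithin_extChartAt_symm hz).inverse_apply_self _
  rw [← VectorField.mlieBracketWithin_univ, VectorField.mlieBracketWithin_apply]
  have h : VectorField.lieBracketWithin ℝ
      (VectorField.mpullbackWithin 𝓘(ℝ, E) 𝓘(ℝ, E) (extChartAt 𝓘(ℝ, E) x).symm
        (FiberBundle.extend E u) (range 𝓘(ℝ, E)))
      (VectorField.mpullbackWithin 𝓘(ℝ, E) 𝓘(ℝ, E) (extChartAt 𝓘(ℝ, E) x).symm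
        (FiberBundle.extend E v) (range 𝓘(ℝ, E)))
      ((extChartAt 𝓘(ℝ, E) x).symm ⁻¹' univ ∩ range 𝓘(ℝ, E)) (extChartAt 𝓘(ℝ, E) x x) = 0 := by
    refine ((key u).lieBracketWithin_vectorField_eq_nhds (key v)).trans ?_
    simp [VectorField.lieBracketWithin_eq]
  exact (congrArg _ h).trans (map_zero _)

theorem mvfderiv_extend_eventuallyEq {f : M → ℝ} {x : M}
    (hf : ∀ᶠ y in 𝓝 x, MDifferentiableAt 𝓘(ℝ, E) 𝓘(ℝ, ℝ) f y) (v : TangentSpace 𝓘(ℝ, E) x) :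
    (fun y ↦ mvfderiv 𝓘(ℝ, E) f y (FiberBundle.extend E v y)) =ᶠ[𝓝 x]
      fun y ↦ fderiv ℝ (f ∘ (extChartAt 𝓘(ℝ, E) x).symm) (extChartAt 𝓘(ℝ, E) x y)
        ((trivializationAt E (TangentSpace 𝓘(ℝ, E) : M → Type _) x).continuousLinearMapAt
        ℝ x v) := by
  filter_upwards [hf, extChartAt_source_mem_nhds (I := 𝓘(ℝ, E)) x] with y hfy hy
  have hy' : y ∈ (chartAt E x).source := by simpa using hy
  rw [extend_eq_symmL _ (by simpa using hy'), TangentBundle.symmL_trivializationAt hy']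
  have hinv := (extChartAt 𝓘(ℝ, E) x).left_inv hy
  have h1 : MDifferentiableAt 𝓘(ℝ, E) 𝓘(ℝ, E) (extChartAt 𝓘(ℝ, E) x).symm
      (extChartAt 𝓘(ℝ, E) x y) := by
    have := mdifferentiableWithinAt_extChartAt_symm ((extChartAt 𝓘(ℝ, E) x).map_source hy)
    simpa [mdifferentiableWithinAt_univ] using this
  have h2 := mfderiv_comp_of_eq (I'' := 𝓘(ℝ, ℝ)) hfy h1 hinv
  rw [mfderiv_eq_fderiv] at h2
  rw [h2]
  simp only [modelWithCornersSelf_coe, range_id, mfderivWithin_univ]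
  rw [hinv]
  rfl

/-- Since the extensions are constant in the chart at `x`, both sides are the second derivative of
`f` read in that chart. -/
theorem mvfderiv_mvfderiv_extend {f : M → ℝ} {x : M}
    (hf : ∀ᶠ y in 𝓝 x, ContMDiffAt 𝓘(ℝ, E) 𝓘(ℝ, ℝ) ∞ f y) (u v : TangentSpace 𝓘(ℝ, E) x) :
    mvfderiv 𝓘(ℝ, E) (fun y ↦ mvfderiv 𝓘(ℝ, E) f y (FiberBundle.extend E v y)) x u =
      mvfderiv 𝓘(ℝ, E) (fun y ↦ mvfderiv 𝓘(ℝ, E) f y (FiberBundle.extend E u y)) x v := by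
  have hF : ContDiffAt ℝ ∞ (f ∘ (extChartAt 𝓘(ℝ, E) x).symm) (extChartAt 𝓘(ℝ, E) x x) := by
    have h := (contMDiffOn_extChartAt_symm (I := 𝓘(ℝ, E)) (n := ∞) x).contMDiffAt
      (extChartAt_target_mem_nhds (I := 𝓘(ℝ, E)) x)
    exact (ContMDiffAt.comp_of_eq hf.self_of_nhds h (extChartAt_to_inv x)).contDiffAt
  have key : ∀ u v : TangentSpace 𝓘(ℝ, E) x,
      mvfderiv 𝓘(ℝ, E) (fun y ↦ mvfderiv 𝓘(ℝ, E) f y (FiberBundle.extend E v y)) x u =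
      fderiv ℝ (fderiv ℝ (f ∘ (extChartAt 𝓘(ℝ, E) x).symm)) (extChartAt 𝓘(ℝ, E) x x)
        (mfderiv 𝓘(ℝ, E) 𝓘(ℝ, E) (extChartAt 𝓘(ℝ, E) x) x u)
        (mfderiv 𝓘(ℝ, E) 𝓘(ℝ, E) (extChartAt 𝓘(ℝ, E) x) x v) := by
    intro u v
    have h1 := mvfderiv_extend_eventuallyEq (hf.mono fun y hy ↦ hy.mdifferentiableAt (by simp)) v
    have hd : DifferentiableAt ℝ (fderiv ℝ (f ∘ (extChartAt 𝓘(ℝ, E) x).symm))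
        (extChartAt 𝓘(ℝ, E) x x) :=
      (hF.fderiv_right (m := ∞) (by simp)).differentiableAt (by simp)
    rw [TangentBundle.continuousLinearMapAt_trivializationAt (mem_chart_source E x)] at h1
    set v' : E := mfderiv 𝓘(ℝ, E) 𝓘(ℝ, E) (extChartAt 𝓘(ℝ, E) x) x v with hv'
    have hd' : DifferentiableAt ℝ
        (fun z ↦ fderiv ℝ (f ∘ (extChartAt 𝓘(ℝ, E) x).symm) z v') (extChartAt 𝓘(ℝ, E) x x) :=
      hd.clm_apply (differentiableAt_const _)
    have h2 := mvfderiv_comp_apply (I := 𝓘(ℝ, E)) (I' := 𝓘(ℝ, E)) x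
      (g := fun z ↦ fderiv ℝ (f ∘ (extChartAt 𝓘(ℝ, E) x).symm) z v')
      (f := extChartAt 𝓘(ℝ, E) x) hd'.mdifferentiableAt
      (mdifferentiableAt_extChartAt (mem_chart_source E x)) u
    have h3 : mvfderiv 𝓘(ℝ, E) (fun y ↦ mvfderiv 𝓘(ℝ, E) f y (FiberBundle.extend E v y)) x =
        mvfderiv 𝓘(ℝ, E) ((fun z ↦ fderiv ℝ (f ∘ (extChartAt 𝓘(ℝ, E) x).symm) z v') ∘
          extChartAt 𝓘(ℝ, E) x) x := mvfderiv_congr h1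
    rw [h3, h2]
    have h4 : fderiv ℝ (fun z ↦ fderiv ℝ (f ∘ (extChartAt 𝓘(ℝ, E) x).symm) z v')
        (extChartAt 𝓘(ℝ, E) x x) = (fderiv ℝ (fderiv ℝ (f ∘ (extChartAt 𝓘(ℝ, E) x).symm))
          (extChartAt 𝓘(ℝ, E) x x)).flip v' := by
      rw [fderiv_clm_apply hd (differentiableAt_const _)]
      simp
    have h5 := congrArg (fun L : E →L[ℝ] ℝ ↦ L (mfderiv 𝓘(ℝ, E) 𝓘(ℝ, E) (extChartAt 𝓘(ℝ, E) x) x u))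
      h4
    rw [← mfderiv_eq_fderiv] at h5
    exact h5
  rw [key, key]
  exact (hF.isSymmSndFDerivAt (by simp; exact WithTop.coe_le_coe.2 (le_top (a := (2 : ℕ∞))))).eq _ _

theorem hess_symm [FiniteDimensional ℝ E]
    {nabla : CovariantDerivative 𝓘(ℝ, E) E (TangentSpace 𝓘(ℝ, E) : M → Type _)}
    (htors : IsTorsionFree nabla) {f : M → ℝ} {x : M}
    (hf : ∀ᶠ y in 𝓝 x, ContMDiffAt 𝓘(ℝ, E) 𝓘(ℝ, ℝ) ∞ f y) (u v : TangentSpace 𝓘(ℝ, E) x) :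
    hess nabla f x u v = hess nabla f x v u := by
  have : CompleteSpace E := FiniteDimensional.complete ℝ E
  have h := nabla.torsion_eq_zero_iff.1 htors (FiberBundle.mdifferentiableAt_extend 𝓘(ℝ, E) E u)
    (FiberBundle.mdifferentiableAt_extend 𝓘(ℝ, E) E v)
  rw [mlieBracket_extend, sub_eq_zero] at h
  simp only [FiberBundle.extend_apply_self] at h
  simp only [hess, covDeriv₁]
  rw [h, mvfderiv_mvfderiv_extend hf]

end Symmetry

/-! ### Differentiation along a curve -/

/-- A product rule that needs the derivative of `B` only for fixed arguments. Split `B(c, d) = B(c -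
c₀, d) + B(c₀, d - d₀) + B(c₀, d₀)` and expand the first two terms in a basis: the factors `c - c₀`,
`d - d₀` vanish at `t₀`, so `B` is differentiated in the last term only. -/
theorem hasDerivWithinAt_bilinear {E : Type*} [NormedAddCommGroup E] [NormedSpace ℝ E]
    [FiniteDimensional ℝ E] {B : ℝ → E → E → ℝ} {D : E → E → ℝ} {s : Set ℝ} {t₀ : ℝ} (ht₀ : t₀ ∈ s)
    (hbil : ∀ᶠ t in 𝓝[s] t₀, ∃ L : E →ₗ[ℝ] E →ₗ[ℝ] ℝ, ∀ a b, B t a b = L a b)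
    (hB : ∀ a b, HasDerivWithinAt (fun t ↦ B t a b) (D a b) s t₀)
    {c d : ℝ → E} {c' d' : E} (hc : HasDerivWithinAt c c' s t₀) (hd : HasDerivWithinAt d d' s t₀) :
    HasDerivWithinAt (fun t ↦ B t (c t) (d t))
      (B t₀ c' (d t₀) + B t₀ (c t₀) d' + D (c t₀) (d t₀)) s t₀ := by
  let b := Module.finBasis ℝ E
  let φ : Fin (Module.finrank ℝ E) → E →L[ℝ] ℝ := fun i ↦ LinearMap.toContinuousLinearMap (b.coord i)
  have hφ : ∀ a : E, ∑ i, φ i a • b i = a := fun a ↦ b.sum_repr a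
  have hc₀ : HasDerivWithinAt (fun t ↦ c t - c t₀) c' s t₀ := hc.sub_const _
  have hd₀ : HasDerivWithinAt (fun t ↦ d t - d t₀) d' s t₀ := hd.sub_const _
  have h1 : HasDerivWithinAt
      (fun t ↦ ∑ i, ∑ j, φ i (c t - c t₀) * (φ j (d t) * B t (b i) (b j)))
      (∑ i, ∑ j, φ i c' * (φ j (d t₀) * B t₀ (b i) (b j))) s t₀ := by
    refine HasDerivWithinAt.fun_sum fun i _ ↦ HasDerivWithinAt.fun_sum fun j _ ↦ ?_
    have h := ((φ i).hasFDerivAt.comp_hasDerivWithinAt t₀ hc₀).mul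
      (((φ j).hasFDerivAt.comp_hasDerivWithinAt t₀ hd).mul (hB (b i) (b j)))
    refine h.congr_deriv ?_
    simp
  have h2 : HasDerivWithinAt (fun t ↦ ∑ j, φ j (d t - d t₀) * B t (c t₀) (b j))
      (∑ j, φ j d' * B t₀ (c t₀) (b j)) s t₀ := by
    refine HasDerivWithinAt.fun_sum fun j _ ↦ ?_
    have h := ((φ j).hasFDerivAt.comp_hasDerivWithinAt t₀ hd₀).mul (hB (c t₀) (b j))
    refine h.congr_deriv ?_
    simp
  have expand₂ : ∀ t, (∃ L : E →ₗ[ℝ] E →ₗ[ℝ] ℝ, ∀ a b, B t a b = L a b) → ∀ a e,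
      ∑ j, φ j e * B t a (b j) = B t a e := by
    rintro t ⟨L, hL⟩ a e
    conv_rhs => rw [← hφ e]
    simp [hL]
  have expand₁ : ∀ t, (∃ L : E →ₗ[ℝ] E →ₗ[ℝ] ℝ, ∀ a b, B t a b = L a b) → ∀ a e,
      ∑ i, ∑ j, φ i a * (φ j e * B t (b i) (b j)) = B t a e := by
    rintro t hL a e
    simp only [← Finset.mul_sum, expand₂ t hL]
    obtain ⟨L, hL⟩ := hL
    conv_rhs => rw [← hφ a]
    simp [hL]
  have h0 := hbil.self_of_nhdsWithin ht₀
  have h := (h1.add h2).add (hB (c t₀) (d t₀))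
  rw [expand₁ t₀ h0, expand₂ t₀ h0] at h
  have key : ∀ t, (∃ L : E →ₗ[ℝ] E →ₗ[ℝ] ℝ, ∀ a b, B t a b = L a b) → B t (c t) (d t) =
      ∑ i, ∑ j, φ i (c t - c t₀) * (φ j (d t) * B t (b i) (b j)) +
        ∑ j, φ j (d t - d t₀) * B t (c t₀) (b j) + B t (c t₀) (d t₀) := by
    intro t hL
    rw [expand₁ t hL, expand₂ t hL]
    obtain ⟨L, hL⟩ := hL
    simp [hL]
  exact h.congr_of_eventuallyEq (hbil.mono key) (key t₀ h0)

theorem hasDerivWithinAt_comp_curve {E : Type*} [NormedAddCommGroup E] [NormedSpace ℝ E]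
    {M : Type*} [TopologicalSpace M] [ChartedSpace E M] {g : M → ℝ} {γ : ℝ → M} {s : Set ℝ} {t₀ : ℝ}
    (hs : UniqueDiffWithinAt ℝ s t₀) (hg : MDifferentiableAt 𝓘(ℝ, E) 𝓘(ℝ, ℝ) g (γ t₀))
    (hγ : MDifferentiableWithinAt 𝓘(ℝ, ℝ) 𝓘(ℝ, E) γ s t₀) :
    HasDerivWithinAt (fun t ↦ g (γ t)) (mvfderiv 𝓘(ℝ, E) g (γ t₀) (velocity γ s t₀)) s t₀ := by
  have h1 := mfderiv_comp_mfderivWithin t₀ hg hγ hs.uniqueMDiffWithinAt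
  have h2 := (hg.comp_mdifferentiableWithinAt t₀ hγ).differentiableWithinAt
  refine h2.hasDerivWithinAt.congr_deriv ?_
  rw [mfderivWithin_eq_fderivWithin] at h1
  exact congrArg (fun L : ℝ →L[ℝ] ℝ ↦ L 1) h1

/-! ### Linearity of the connection on extended vectors -/

section CovariantDerivative

variable {E : Type*} [NormedAddCommGroup E] [NormedSpace ℝ E]
  {M : Type*} [TopologicalSpace M] [ChartedSpace E M] [IsManifold 𝓘(ℝ, E) ∞ M]

variable {x : M} (nabla : CovariantDerivative 𝓘(ℝ, E) E (TangentSpace 𝓘(ℝ, E) : M → Type _))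

theorem nabla_extend_add (v w : TangentSpace 𝓘(ℝ, E) x) :
    nabla (FiberBundle.extend E (v + w)) x =
      nabla (FiberBundle.extend E v) x + nabla (FiberBundle.extend E w) x := by
  have hv := FiberBundle.mdifferentiableAt_extend 𝓘(ℝ, E) E v
  have hw := FiberBundle.mdifferentiableAt_extend 𝓘(ℝ, E) E w
  rw [← nabla.isCovariantDerivativeOnUniv.add hv hw]
  exact nabla.isCovariantDerivativeOnUniv.congr_of_eventuallyEq
    (FiberBundle.mdifferentiableAt_extend 𝓘(ℝ, E) E (v + w)) (mdifferentiableAt_add_section hv hw)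
    Filter.univ_mem (extend_add_eventuallyEq v w)

theorem nabla_extend_smul (c : ℝ) (v : TangentSpace 𝓘(ℝ, E) x) :
    nabla (FiberBundle.extend E (c • v)) x = c • nabla (FiberBundle.extend E v) x := by
  have hv := FiberBundle.mdifferentiableAt_extend 𝓘(ℝ, E) E v
  rw [← nabla.isCovariantDerivativeOnUniv.smul_const c hv]
  exact nabla.isCovariantDerivativeOnUniv.congr_of_eventuallyEq
    (FiberBundle.mdifferentiableAt_extend 𝓘(ℝ, E) E (c • v)) (hv.smul_const_section (a := c))
    Filter.univ_mem (extend_smul_eventuallyEq c v)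

end CovariantDerivative

/-! ### The Hessian metric on parallel and dually parallel fields -/

section AlongCurve

variable {E : Type*} [NormedAddCommGroup E] [NormedSpace ℝ E] [FiniteDimensional ℝ E]
  {M : Type*} [TopologicalSpace M] [T2Space M] [ChartedSpace E M] [IsManifold 𝓘(ℝ, E) ∞ M]
  (nabla : CovariantDerivative 𝓘(ℝ, E) E (TangentSpace 𝓘(ℝ, E) : M → Type _))
  [CovariantDerivative.ContMDiffCovariantDerivative nabla ∞]

/-- The product rule in the trivialization at `γ t₀`: two terms differentiate the coordinates of the
fields, the third differentiates the metric with those coordinates frozen. -/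
theorem hasDerivWithinAt_hess_along {f : M → ℝ} {γ : ℝ → M} {s : Set ℝ} {t₀ : ℝ} (ht₀ : t₀ ∈ s)
    (hs : UniqueDiffWithinAt ℝ s t₀) (hγ : MDifferentiableWithinAt 𝓘(ℝ, ℝ) 𝓘(ℝ, E) γ s t₀)
    (hf : ∀ᶠ y in 𝓝 (γ t₀), ContMDiffAt 𝓘(ℝ, E) 𝓘(ℝ, ℝ) ∞ f y)
    {V W : ∀ t, TangentSpace 𝓘(ℝ, E) (γ t)}
    (hV : DifferentiableWithinAt ℝ (localCoord γ V t₀) s t₀)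
    (hW : DifferentiableWithinAt ℝ (localCoord γ W t₀) s t₀) :
    HasDerivWithinAt (fun t ↦ hess nabla f (γ t) (V t) (W t))
      (hess nabla f (γ t₀) ((trivializationAt E (TangentSpace 𝓘(ℝ, E) : M → Type _) (γ t₀)).symmL ℝ
          (γ t₀) (derivWithin (localCoord γ V t₀) s t₀)) (W t₀) +
        hess nabla f (γ t₀) (V t₀) ((trivializationAt E (TangentSpace 𝓘(ℝ, E) : M → Type _)
          (γ t₀)).symmL ℝ (γ t₀) (derivWithin (localCoord γ W t₀) s t₀)) +
        mvfderiv 𝓘(ℝ, E) (fun y ↦ hess nabla f y (FiberBundle.extend E (V t₀) y)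
          (FiberBundle.extend E (W t₀) y)) (γ t₀) (velocity γ s t₀)) s t₀ := by
  have hbase : ∀ᶠ t in 𝓝[s] t₀, γ t ∈
      (trivializationAt E (TangentSpace 𝓘(ℝ, E) : M → Type _) (γ t₀)).baseSet :=
    hγ.continuousWithinAt.eventually (eventually_mem_baseSet (E := E) (γ t₀))
  have hbase₀ := hbase.self_of_nhdsWithin ht₀
  have hft := hγ.continuousWithinAt.eventually hf
  set T := trivializationAt E (TangentSpace 𝓘(ℝ, E) : M → Type _) (γ t₀) with hT
  have key := hasDerivWithinAt_bilinear (E := E) (s := s) (t₀ := t₀)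
    (B := fun t a b ↦ hess nabla f (γ t) (T.symmL ℝ (γ t) a) (T.symmL ℝ (γ t) b))
    (D := fun a b ↦ mvfderiv 𝓘(ℝ, E) (fun y ↦ hess nabla f y
      (FiberBundle.extend E (T.symmL ℝ (γ t₀) a) y) (FiberBundle.extend E (T.symmL ℝ (γ t₀) b) y))
      (γ t₀) (velocity γ s t₀)) ht₀ ?_ ?_ hV.hasDerivWithinAt hW.hasDerivWithinAt
  · have e : ∀ (Z : ∀ t, TangentSpace 𝓘(ℝ, E) (γ t)) (t : ℝ), γ t ∈ T.baseSet →
        T.symmL ℝ (γ t) (localCoord γ Z t₀ t) = Z t := fun Z t ht ↦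
      T.symmL_continuousLinearMapAt ht _
    simp only [e V t₀ hbase₀, e W t₀ hbase₀] at key
    refine key.congr_of_eventuallyEq (hbase.mono fun t ht ↦ ?_) ?_
    · simp only [e V t ht, e W t ht]
    · simp only [e V t₀ hbase₀, e W t₀ hbase₀]
  · filter_upwards [hft] with t ht
    exact ⟨(hessBilin nabla ht).compl₁₂ (T.symmL ℝ (γ t)).toLinearMap
      (T.symmL ℝ (γ t)).toLinearMap, fun a b ↦ rfl⟩
  · intro a b
    have h := hasDerivWithinAt_comp_curve hs ((contMDiffAt_hess_extend nabla hf
      (T.symmL ℝ (γ t₀) a) (T.symmL ℝ (γ t₀) b)).mdifferentiableAt (by simp)) hγ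
    have e : ∀ a t, γ t ∈ T.baseSet → FiberBundle.extend E (T.symmL ℝ (γ t₀) a) (γ t) =
        T.symmL ℝ (γ t) a := fun a t ht ↦ by
      rw [extend_eq_symmL _ ht, T.continuousLinearMapAt_symmL hbase₀]
    refine h.congr_of_eventuallyEq (hbase.mono fun t ht ↦ ?_) ?_
    · simp only [e _ t ht]
    · simp only [e _ t₀ hbase₀]

/-- Along a curve, the metric of two parallel fields changes by the covariant derivative of the
metric. -/
theorem hasDerivWithinAt_hess_parallel {f : M → ℝ} {γ : ℝ → M} {s : Set ℝ} {t₀ : ℝ} (ht₀ : t₀ ∈ s)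
    (hs : UniqueDiffWithinAt ℝ s t₀) (hγ : MDifferentiableWithinAt 𝓘(ℝ, ℝ) 𝓘(ℝ, E) γ s t₀)
    (hf : ∀ᶠ y in 𝓝 (γ t₀), ContMDiffAt 𝓘(ℝ, E) 𝓘(ℝ, ℝ) ∞ f y)
    {V W : ∀ t, TangentSpace 𝓘(ℝ, E) (γ t)}
    (hV : IsParallelAlong nabla γ s V) (hW : IsParallelAlong nabla γ s W) :
    HasDerivWithinAt (fun t ↦ hess nabla f (γ t) (V t) (W t))
      (covDeriv₂ nabla (hess nabla f) (γ t₀) (velocity γ s t₀) (V t₀) (W t₀)) s t₀ := by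
  obtain ⟨hVd, hV0⟩ := hV t₀ ht₀
  obtain ⟨hWd, hW0⟩ := hW t₀ ht₀
  refine (hasDerivWithinAt_hess_along nabla ht₀ hs hγ hf hVd hWd).congr_deriv ?_
  -- For a parallel field the coordinate derivative is minus the connection term, which supplies the
  -- two corrections in `covDeriv₂`.
  rw [covDerivAlong, add_eq_zero_iff_eq_neg] at hV0 hW0
  rw [hV0, hW0]
  simp only [← hessBilin_apply nabla hf.self_of_nhds, map_neg, LinearMap.neg_apply, covDeriv₂]
  ring

variable {f : M → ℝ} {x : M}

theorem mvfderiv_hess_extend_add (hf : ∀ᶠ y in 𝓝 x, ContMDiffAt 𝓘(ℝ, E) 𝓘(ℝ, ℝ) ∞ f y)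
    (z v w : TangentSpace 𝓘(ℝ, E) x) :
    mvfderiv 𝓘(ℝ, E) (fun y ↦ hess nabla f y (FiberBundle.extend E z y)
      (FiberBundle.extend E (v + w) y)) x =
    mvfderiv 𝓘(ℝ, E) (fun y ↦ hess nabla f y (FiberBundle.extend E z y)
      (FiberBundle.extend E v y)) x +
    mvfderiv 𝓘(ℝ, E) (fun y ↦ hess nabla f y (FiberBundle.extend E z y)
      (FiberBundle.extend E w y)) x := by
  rw [← mvfderiv_add ((contMDiffAt_hess_extend nabla hf z v).mdifferentiableAt (by simp))
    ((contMDiffAt_hess_extend nabla hf z w).mdifferentiableAt (by simp))]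
  apply mvfderiv_congr
  filter_upwards [hf, extend_add_eventuallyEq v w] with y hy hvw
  rw [hvw, Pi.add_apply]
  exact (hessBilin nabla hy _).map_add _ _

theorem mvfderiv_hess_extend_smul (hf : ∀ᶠ y in 𝓝 x, ContMDiffAt 𝓘(ℝ, E) 𝓘(ℝ, ℝ) ∞ f y)
    (z : TangentSpace 𝓘(ℝ, E) x) (c : ℝ) (v : TangentSpace 𝓘(ℝ, E) x) :
    mvfderiv 𝓘(ℝ, E) (fun y ↦ hess nabla f y (FiberBundle.extend E z y)
      (FiberBundle.extend E (c • v) y)) x =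
    c • mvfderiv 𝓘(ℝ, E) (fun y ↦ hess nabla f y (FiberBundle.extend E z y)
      (FiberBundle.extend E v y)) x := by
  have h := mvfderiv_mul (I := 𝓘(ℝ, E)) (f := fun _ ↦ c) mdifferentiableAt_const
    ((contMDiffAt_hess_extend nabla hf z v).mdifferentiableAt (by simp))
  simp only [mvfderiv_const, smul_zero, add_zero] at h
  rw [← h]
  apply mvfderiv_congr
  filter_upwards [hf, extend_smul_eventuallyEq c v] with y hy hv
  rw [hv, Pi.mul_apply]
  exact (hessBilin nabla hy _).map_smul _ _

/-- The defining equation of the dual connection. -/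
theorem hess_dualConnection (hf : ∀ᶠ y in 𝓝 x, ContMDiffAt 𝓘(ℝ, E) 𝓘(ℝ, ℝ) ∞ f y)
    (hpos : ∀ u : TangentSpace 𝓘(ℝ, E) x, u ≠ 0 → 0 < hess nabla f x u u)
    (z u v : TangentSpace 𝓘(ℝ, E) x) :
    hess nabla f x (dualConnection nabla f (FiberBundle.extend E z) x u) v =
      mvfderiv 𝓘(ℝ, E) (fun y ↦ hess nabla f y (FiberBundle.extend E z y)
        (FiberBundle.extend E v y)) x u - hess nabla f x z (nabla (FiberBundle.extend E v) x u) := by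
  have hex : ∃ L : TangentSpace 𝓘(ℝ, E) x →L[ℝ] TangentSpace 𝓘(ℝ, E) x,
      ∀ u v, hess nabla f x (L u) v =
        covDeriv₁ nabla (fun y w ↦ hess nabla f y (FiberBundle.extend E z y) w) x u v := by
    let B := hessBilin nabla hf.self_of_nhds
    let R : TangentSpace 𝓘(ℝ, E) x →ₗ[ℝ] TangentSpace 𝓘(ℝ, E) x →ₗ[ℝ] ℝ :=
      LinearMap.mk₂ ℝ
        (covDeriv₁ nabla (fun y w ↦ hess nabla f y (FiberBundle.extend E z y) w) x)
        (fun u u' v ↦ by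
          simp only [covDeriv₁, map_add, ← hessBilin_apply nabla hf.self_of_nhds]
          ring)
        (fun c u v ↦ by
          simp only [covDeriv₁, map_smul, ← hessBilin_apply nabla hf.self_of_nhds, smul_eq_mul]
          ring)
        (fun u v v' ↦ by
          simp only [covDeriv₁, mvfderiv_hess_extend_add nabla hf, nabla_extend_add,
            ← hessBilin_apply nabla hf.self_of_nhds, add_apply, map_add]
          ring)
        (fun c u v ↦ by
          simp only [covDeriv₁, mvfderiv_hess_extend_smul nabla hf, nabla_extend_smul,
            ← hessBilin_apply nabla hf.self_of_nhds, smul_apply, map_smul, smul_eq_mul]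
          ring)
    have : FiniteDimensional ℝ (TangentSpace 𝓘(ℝ, E) x) := inferInstanceAs (FiniteDimensional ℝ E)
    have : T2Space (TangentSpace 𝓘(ℝ, E) x) := inferInstanceAs (T2Space E)
    have hB : Function.Injective B := by
      rw [injective_iff_map_eq_zero]
      intro a ha
      by_contra hne
      exact (hpos a hne).ne' (congrArg (fun L ↦ L a) ha)
    -- A positive definite form identifies the tangent space with its dual, so `L` is the inverse
    -- identification composed with `R`.
    let e := LinearMap.linearEquivOfInjective B hB Subspace.dual_finrank_eq.symm
    refine ⟨LinearMap.toContinuousLinearMap (e.symm.toLinearMap ∘ₗ R), fun u v ↦ ?_⟩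
    exact congrArg (fun L ↦ L v) (e.apply_symm_apply (R u))
  have h : hess nabla f x (dualConnection nabla f (FiberBundle.extend E z) x u) v =
      covDeriv₁ nabla (fun y w ↦ hess nabla f y (FiberBundle.extend E z y) w) x u v := by
    rw [dualConnection, dif_pos hex]
    exact hex.choose_spec u v
  rw [h, covDeriv₁, FiberBundle.extend_apply_self]

/-- The metric of a dually parallel field and a parallel field is constant. -/
theorem hasDerivWithinAt_hess_dual_parallel {γ : ℝ → M} {s : Set ℝ} {t₀ : ℝ}
    (ht₀ : t₀ ∈ s)
    (hs : UniqueDiffWithinAt ℝ s t₀) (hγ : MDifferentiableWithinAt 𝓘(ℝ, ℝ) 𝓘(ℝ, E) γ s t₀)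
    (hf : ∀ᶠ y in 𝓝 (γ t₀), ContMDiffAt 𝓘(ℝ, E) 𝓘(ℝ, ℝ) ∞ f y)
    (hpos : ∀ u : TangentSpace 𝓘(ℝ, E) (γ t₀), u ≠ 0 → 0 < hess nabla f (γ t₀) u u)
    {V W : ∀ t, TangentSpace 𝓘(ℝ, E) (γ t)}
    (hV : IsParallelAlong (dualConnection nabla f) γ s V) (hW : IsParallelAlong nabla γ s W) :
    HasDerivWithinAt (fun t ↦ hess nabla f (γ t) (V t) (W t)) 0 s t₀ := by
  obtain ⟨hVd, hV0⟩ := hV t₀ ht₀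
  obtain ⟨hWd, hW0⟩ := hW t₀ ht₀
  refine (hasDerivWithinAt_hess_along nabla ht₀ hs hγ hf hVd hWd).congr_deriv ?_
  rw [covDerivAlong, add_eq_zero_iff_eq_neg] at hV0 hW0
  have h := hess_dualConnection nabla hf hpos (V t₀) (velocity γ s t₀) (W t₀)
  rw [hV0, hW0]
  simp only [← hessBilin_apply nabla hf.self_of_nhds, map_neg, LinearMap.neg_apply] at h ⊢
  rw [h]
  ring

end AlongCurve

/-! ### Differential inequalities on the unit interval -/

section Comparison

/-- With `w = √h` the hypothesis reads `|w'| ≤ σ w²`, so `1/w + σt` is nondecreasing. The conclusion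
is free of division and so allows `w = 0`. -/
theorem sqrt_mul_le_of_abs_deriv_le {h h' : ℝ → ℝ} {σ : ℝ}
    (hpos : ∀ t ∈ Icc (0 : ℝ) 1, 0 ≤ h t)
    (hd : ∀ t ∈ Icc (0 : ℝ) 1, HasDerivWithinAt h (h' t) (Icc 0 1) t) (hσ : 0 ≤ σ)
    (hb : ∀ t ∈ Icc (0 : ℝ) 1, |h' t| ≤ 2 * σ * √(h t) * h t) {t : ℝ} (ht : t ∈ Icc (0 : ℝ) 1) :
    √(h t) * (1 - σ * √(h 0) * t) ≤ √(h 0) := by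
  -- Adding `ε` keeps the root positive and differentiable where `h` vanishes, and preserves the
  -- bound on `h'`; finally `ε → 0`.
  have key : ∀ ε > 0, √(h t + ε) * (1 - σ * √(h 0 + ε) * t) ≤ √(h 0 + ε) := by
    intro ε hε
    have hq : ∀ s ∈ Icc (0 : ℝ) 1, 0 < h s + ε := fun s hs ↦ by linarith [hpos s hs]
    have hk : ∀ s ∈ Icc (0 : ℝ) 1, HasDerivWithinAt (fun s ↦ (√(h s + ε))⁻¹ + σ * s)
        (-(h' s / (2 * √(h s + ε))) / √(h s + ε) ^ 2 + σ * 1) (Icc 0 1) s := fun s hs ↦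
      ((((hd s hs).add_const ε).sqrt (hq s hs).ne').inv (Real.sqrt_pos.2 (hq s hs)).ne').add
        ((hasDerivWithinAt_id s _).const_mul σ)
    have hmono := monotoneOn_of_hasDerivWithinAt_nonneg (convex_Icc (0 : ℝ) 1)
      (fun s hs ↦ (hk s hs).continuousWithinAt)
      (fun s hs ↦ (hk s (interior_subset hs)).mono interior_subset) (fun s hs ↦ by
        have hs := interior_subset hs
        have hqs := Real.sqrt_pos.2 (hq s hs)
        have hle : √(h s) ≤ √(h s + ε) := Real.sqrt_le_sqrt (by linarith)
        have hsq := Real.sq_sqrt (hq s hs).le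
        have h1 : h' s ≤ 2 * σ * √(h s + ε) * √(h s + ε) ^ 2 := by
          refine (le_abs_self _).trans ((hb s hs).trans ?_)
          rw [hsq]
          have := hpos s hs
          gcongr
          linarith
        have h2 : h' s / (2 * √(h s + ε)) / √(h s + ε) ^ 2 ≤ σ := by
          rw [div_div, div_le_iff₀ (by positivity)]
          linarith
        rw [neg_div]
        linarith)
    have h1 := hmono (left_mem_Icc.2 zero_le_one) ht ht.1
    have hq0 := Real.sqrt_pos.2 (hq 0 (left_mem_Icc.2 zero_le_one))
    have hqt := Real.sqrt_pos.2 (hq t ht)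
    simp only [mul_zero, add_zero] at h1
    have h2 := mul_le_mul_of_nonneg_left h1 (mul_pos hq0 hqt).le
    have h3 : √(h 0 + ε) * √(h t + ε) * (√(h 0 + ε))⁻¹ = √(h t + ε) := by field_simp
    have h4 : √(h 0 + ε) * √(h t + ε) * ((√(h t + ε))⁻¹ + σ * t) =
        √(h 0 + ε) + √(h 0 + ε) * √(h t + ε) * σ * t := by field_simp
    rw [h3, h4] at h2
    linarith
  have hc1 : Continuous fun ε ↦ √(h t + ε) * (1 - σ * √(h 0 + ε) * t) := by fun_prop
  have hc2 : Continuous fun ε ↦ √(h 0 + ε) := by fun_prop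
  have := le_of_tendsto_of_tendsto ((hc1.tendsto 0).mono_left (nhdsWithin_le_nhds (s := Ioi 0)))
    ((hc2.tendsto 0).mono_left nhdsWithin_le_nhds)
    (Filter.eventually_of_mem self_mem_nhdsWithin key)
  simpa using this

/-- The two hypotheses combine to `|φ'| (1 - ct) ≤ 2cφ` with `c = σr`. Hence `φ / (1 - ct)²` is
nondecreasing and `φ (1 - ct)²` is nonincreasing. -/
theorem comparison_of_abs_deriv_le {φ φ' w : ℝ → ℝ} {σ r : ℝ} (hσ : 0 ≤ σ) (hr : 0 ≤ r)
    (hσr : σ * r < 1) (hpos : ∀ t ∈ Icc (0 : ℝ) 1, 0 ≤ φ t)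
    (hd : ∀ t ∈ Icc (0 : ℝ) 1, HasDerivWithinAt φ (φ' t) (Icc 0 1) t)
    (hw : ∀ t ∈ Icc (0 : ℝ) 1, w t * (1 - σ * r * t) ≤ r)
    (hb : ∀ t ∈ Icc (0 : ℝ) 1, |φ' t| ≤ 2 * σ * w t * φ t) {t : ℝ} (ht : t ∈ Icc (0 : ℝ) 1) :
    (1 - σ * r * t) ^ 2 * φ 0 ≤ φ t ∧ φ t ≤ 1 / (1 - σ * r * t) ^ 2 * φ 0 := by
  have hc : 0 ≤ σ * r := mul_nonneg hσ hr
  have hp : ∀ s ∈ Icc (0 : ℝ) 1, 0 < 1 - σ * r * s := fun s hs ↦ by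
    nlinarith [hs.1, hs.2]
  have hbp : ∀ s ∈ Icc (0 : ℝ) 1, |φ' s| * (1 - σ * r * s) ≤ 2 * (σ * r) * φ s := fun s hs ↦ by
    have h1 := mul_le_mul_of_nonneg_right (hb s hs) (hp s hs).le
    have h2 := mul_le_mul_of_nonneg_left (hw s hs) (mul_nonneg hσ (hpos s hs))
    linarith
  have hpd : ∀ s : ℝ, HasDerivWithinAt (fun s ↦ (1 - σ * r * s) ^ 2)
      (2 * (1 - σ * r * s) * (-(σ * r))) (Icc 0 1) s := fun s ↦ by
    have := (((hasDerivWithinAt_id s (Icc (0 : ℝ) 1)).const_mul (σ * r)).const_sub 1).pow 2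
    refine this.congr_deriv ?_
    simp
  have h0 : (0 : ℝ) ∈ Icc (0 : ℝ) 1 := left_mem_Icc.2 zero_le_one
  have hpt := hp t ht
  constructor
  · have hdiv : ∀ s ∈ Icc (0 : ℝ) 1, HasDerivWithinAt (fun s ↦ φ s / (1 - σ * r * s) ^ 2) _
        (Icc 0 1) s := fun s hs ↦ (hd s hs).div (hpd s) (pow_pos (hp s hs) 2).ne'
    have hmono := monotoneOn_of_hasDerivWithinAt_nonneg (convex_Icc (0 : ℝ) 1)
      (fun s hs ↦ (hdiv s hs).continuousWithinAt)
      (fun s hs ↦ (hdiv s (interior_subset hs)).mono interior_subset) (fun s hs ↦ by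
        have hs := interior_subset hs
        have hps := hp s hs
        apply div_nonneg _ (by positivity)
        have h1 := mul_le_mul_of_nonneg_right (neg_abs_le (φ' s)) hps.le
        have h2 := hbp s hs
        have h3 : 0 ≤ φ' s * (1 - σ * r * s) + 2 * (σ * r) * φ s := by linarith
        have h4 := mul_nonneg h3 hps.le
        linarith)
    have h1 := hmono h0 ht ht.1
    simp only [mul_zero, sub_zero, one_pow, div_one] at h1
    rw [le_div_iff₀ (by positivity)] at h1
    linarith
  · have hmul : ∀ s ∈ Icc (0 : ℝ) 1, HasDerivWithinAt (fun s ↦ φ s * (1 - σ * r * s) ^ 2) _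
        (Icc 0 1) s := fun s hs ↦ (hd s hs).mul (hpd s)
    have hanti := antitoneOn_of_hasDerivWithinAt_nonpos (convex_Icc (0 : ℝ) 1)
      (fun s hs ↦ (hmul s hs).continuousWithinAt)
      (fun s hs ↦ (hmul s (interior_subset hs)).mono interior_subset) (fun s hs ↦ by
        have hs := interior_subset hs
        have hps := hp s hs
        have h1 := mul_le_mul_of_nonneg_right (le_abs_self (φ' s)) hps.le
        have h2 := hbp s hs
        have h3 : 0 ≤ 2 * (σ * r) * φ s - φ' s * (1 - σ * r * s) := by linarith
        have h4 := mul_nonneg h3 hps.le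
        linarith)
    have h1 := hanti h0 ht ht.1
    simp only [mul_zero, sub_zero, one_pow, mul_one] at h1
    rw [one_div, inv_mul_eq_div, le_div_iff₀ (by positivity)]
    exact h1

theorem integral_one_sub_mul_sq (c : ℝ) :
    ∫ t in (0 : ℝ)..1, (1 - c * t) ^ 2 = 1 - c + 1 / 3 * c ^ 2 := by
  have h : ∀ t ∈ uIcc (0 : ℝ) 1, HasDerivAt (fun t ↦ t - c * t ^ 2 + c ^ 2 / 3 * t ^ 3)
      ((1 - c * t) ^ 2) t := fun t _ ↦ by
    have := ((hasDerivAt_id t).sub (((hasDerivAt_id t).pow 2).const_mul c)).add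
      (((hasDerivAt_id t).pow 3).const_mul (c ^ 2 / 3))
    refine this.congr_deriv ?_
    simp
    ring
  rw [intervalIntegral.integral_eq_sub_of_hasDerivAt h
    (Continuous.intervalIntegrable (by fun_prop) _ _)]
  ring

theorem one_sub_mul_pos_of_lt_one {c : ℝ} (hc0 : 0 ≤ c) (hc : c < 1) {t : ℝ}
    (ht : t ∈ Icc (0 : ℝ) 1) : 0 < 1 - c * t := by
  nlinarith [ht.1, ht.2]

theorem intervalIntegrable_one_div_one_sub_mul_sq {c : ℝ} (hc0 : 0 ≤ c) (hc : c < 1) :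
    IntervalIntegrable (fun t ↦ 1 / (1 - c * t) ^ 2) MeasureTheory.volume 0 1 := by
  refine ContinuousOn.intervalIntegrable_of_Icc zero_le_one fun t ht ↦ ?_
  have hp := one_sub_mul_pos_of_lt_one hc0 hc ht
  exact ContinuousAt.continuousWithinAt
    (ContinuousAt.div (by fun_prop) (by fun_prop) (pow_pos hp 2).ne')

theorem integral_one_div_one_sub_mul_sq {c : ℝ} (hc0 : 0 ≤ c) (hc : c < 1) :
    ∫ t in (0 : ℝ)..1, 1 / (1 - c * t) ^ 2 = 1 / (1 - c) := by
  have h : ∀ t ∈ uIcc (0 : ℝ) 1, HasDerivAt (fun t ↦ t / (1 - c * t)) (1 / (1 - c * t) ^ 2) t := by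
    intro t ht
    rw [uIcc_of_le zero_le_one] at ht
    have hp := one_sub_mul_pos_of_lt_one hc0 hc ht
    have := (hasDerivAt_id t).div (((hasDerivAt_id t).const_mul c).const_sub 1) hp.ne'
    refine this.congr_deriv ?_
    simp only [id, one_mul, mul_one, one_div]
    rw [show 1 - c * t - t * -c = 1 by ring, one_div]
  rw [intervalIntegral.integral_eq_sub_of_hasDerivAt h
    (intervalIntegrable_one_div_one_sub_mul_sq hc0 hc)]
  simp

end Comparison

/-! ### Curves of endomorphisms tested against a bilinear form -/

section Endomorphisms

variable {E : Type*} [NormedAddCommGroup E] [NormedSpace ℝ E] [FiniteDimensional ℝ E]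

/-- Pairing with a basis is an injective linear map to coordinates, and a linear left inverse
recovers `A t u`. This makes the return transport continuous without studying `δ_t⁻¹` itself. -/
theorem continuousOn_clm_of_bilin {A : ℝ → E →L[ℝ] E} {s : Set ℝ} {B : E →ₗ[ℝ] E →ₗ[ℝ] ℝ}
    (hB : Function.Injective B) (hA : ∀ u v, ContinuousOn (fun t ↦ B (A t u) v) s) :
    ContinuousOn A s := by
  rw [continuousOn_clm_apply]
  intro u
  let b := Module.finBasis ℝ E
  let Ψ : E →ₗ[ℝ] Fin (Module.finrank ℝ E) → ℝ := LinearMap.pi fun i ↦ B.flip (b i)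
  have hΨ : LinearMap.ker Ψ = ⊥ := by
    rw [LinearMap.ker_eq_bot']
    intro a ha
    apply hB
    rw [map_zero]
    exact b.ext fun i ↦ congrFun ha i
  obtain ⟨Φ, hΦ⟩ := Ψ.exists_leftInverse_of_injective hΨ
  have h1 : (fun t ↦ A t u) = fun t ↦ Φ (fun i ↦ B (A t u) (b i)) := by
    funext t
    exact (LinearMap.congr_fun hΦ (A t u)).symm
  rw [h1]
  exact Φ.continuous_of_finiteDimensional.comp_continuousOn
    (continuousOn_pi.2 fun i ↦ hA u (b i))

theorem bilin_intervalIntegral_apply {A : ℝ → E →L[ℝ] E} (B : E →ₗ[ℝ] E →ₗ[ℝ] ℝ)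
    (hA : IntervalIntegrable A MeasureTheory.volume 0 1) (u v : E) :
    B ((∫ t in (0 : ℝ)..1, A t) u) v = ∫ t in (0 : ℝ)..1, B (A t u) v := by
  have : CompleteSpace E := FiniteDimensional.complete ℝ E
  have hu : IntervalIntegrable (fun t ↦ A t u) MeasureTheory.volume 0 1 :=
    ⟨hA.1.apply_continuousLinearMap u, hA.2.apply_continuousLinearMap u⟩
  rw [ContinuousLinearMap.intervalIntegral_apply hA]
  exact ((LinearMap.toContinuousLinearMap (B.flip v)).intervalIntegral_comp_comm hu).symm

end Endomorphisms

theorem IsSelfConcordant.eventually_contMDiffAt {E : Type*} [NormedAddCommGroup E] [NormedSpace ℝ E]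
    {M : Type*} [TopologicalSpace M] [ChartedSpace E M] [IsManifold 𝓘(ℝ, E) ∞ M]
    {nabla : CovariantDerivative 𝓘(ℝ, E) E (TangentSpace 𝓘(ℝ, E) : M → Type _)}
    {C : Set M} {f : M → ℝ} {σ : ℝ} (hf : IsSelfConcordant nabla C f σ)
    {x : M} (hx : x ∈ C) : ∀ᶠ y in 𝓝 x, ContMDiffAt 𝓘(ℝ, E) 𝓘(ℝ, ℝ) ∞ f y := by
  filter_upwards [hf.isOpen.mem_nhds hx] with y hy
  exact hf.smooth.contMDiffAt (hf.isOpen.mem_nhds hy)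

/-! ### Metric estimates for the two transports -/

section Transport

variable {E : Type*} [NormedAddCommGroup E] [NormedSpace ℝ E] [FiniteDimensional ℝ E]
  {M : Type*} [TopologicalSpace M] [ChartedSpace E M] [IsManifold 𝓘(ℝ, E) ∞ M]
  {nabla : CovariantDerivative 𝓘(ℝ, E) E (TangentSpace 𝓘(ℝ, E) : M → Type _)}
  {C : Set M} {f : M → ℝ} {σ : ℝ} {γ : ℝ → M}

theorem IsSelfConcordant.hess_nonneg (hf : IsSelfConcordant nabla C f σ) {x : M} (hx : x ∈ C)
    (u : TangentSpace 𝓘(ℝ, E) x) : 0 ≤ hess nabla f x u u := by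
  rcases eq_or_ne u 0 with rfl | hu
  · have h := (hessBilin nabla (hf.eventually_contMDiffAt hx).self_of_nhds 0).map_zero
    exact h.ge
  · exact (hf.nondegenerate x hx u hu).le

theorem IsSelfConcordant.hess_le_localNorm_mul (hf : IsSelfConcordant nabla C f σ)
    (htors : IsTorsionFree nabla) {x : M} (hx : x ∈ C) (u v : TangentSpace 𝓘(ℝ, E) x) :
    hess nabla f x u v ≤ localNorm nabla f x u * localNorm nabla f x v := by
  have hfx := hf.eventually_contMDiffAt hx
  have h := LinearMap.BilinForm.apply_sq_le_of_symm (hessBilin nabla hfx.self_of_nhds)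
    (fun a ↦ hf.hess_nonneg hx a) ⟨fun a b ↦ hess_symm htors hfx a b⟩ u v
  rw [localNorm, localNorm, ← Real.sqrt_mul (hf.hess_nonneg hx u)]
  exact Real.le_sqrt_of_sq_le h

variable [T2Space M] [CovariantDerivative.ContMDiffCovariantDerivative nabla ∞]

theorem IsGeodesic.hasDerivWithinAt_hess (hγ : IsGeodesic nabla γ 0 1)
    (hf : IsSelfConcordant nabla C f σ) (hγC : ∀ t ∈ Icc (0 : ℝ) 1, γ t ∈ C)
    {V W : ∀ t, TangentSpace 𝓘(ℝ, E) (γ t)}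
    (hV : IsParallelAlong nabla γ (Icc 0 1) V) (hW : IsParallelAlong nabla γ (Icc 0 1) W)
    {t : ℝ} (ht : t ∈ Icc (0 : ℝ) 1) :
    HasDerivWithinAt (fun t ↦ hess nabla f (γ t) (V t) (W t))
      (covDeriv₂ nabla (hess nabla f) (γ t) (velocity γ (Icc 0 1) t) (V t) (W t)) (Icc 0 1) t :=
  hasDerivWithinAt_hess_parallel nabla ht (uniqueDiffOn_Icc_zero_one t ht)
    ((hγ.smooth t ht).mdifferentiableWithinAt (by simp)) (hf.eventually_contMDiffAt (hγC t ht)) hV hW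

/-- Self-concordance enters twice: with `γ̇` as the parallel field, to bound the speed, and then
with `V`. -/
theorem IsGeodesic.hess_comparison (hγ : IsGeodesic nabla γ 0 1)
    (hf : IsSelfConcordant nabla C f σ) (hγC : ∀ t ∈ Icc (0 : ℝ) 1, γ t ∈ C)
    (hσr : σ * localNorm nabla f (γ 0) (velocity γ (Icc 0 1) 0) < 1)
    {V : ∀ t, TangentSpace 𝓘(ℝ, E) (γ t)} (hV : IsParallelAlong nabla γ (Icc 0 1) V)
    {t : ℝ} (ht : t ∈ Icc (0 : ℝ) 1) :
    (1 - σ * localNorm nabla f (γ 0) (velocity γ (Icc 0 1) 0) * t) ^ 2 *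
        hess nabla f (γ 0) (V 0) (V 0) ≤ hess nabla f (γ t) (V t) (V t) ∧
      hess nabla f (γ t) (V t) (V t) ≤
        1 / (1 - σ * localNorm nabla f (γ 0) (velocity γ (Icc 0 1) 0) * t) ^ 2 *
          hess nabla f (γ 0) (V 0) (V 0) := by
  refine comparison_of_abs_deriv_le (φ := fun t ↦ hess nabla f (γ t) (V t) (V t))
    (w := fun t ↦ √(hess nabla f (γ t) (velocity γ (Icc 0 1) t) (velocity γ (Icc 0 1) t)))
    hf.nonneg (Real.sqrt_nonneg _) hσr
    (fun s hs ↦ hf.hess_nonneg (hγC s hs) _)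
    (fun s hs ↦ hγ.hasDerivWithinAt_hess hf hγC hV hV hs) (fun s hs ↦ ?_)
    (fun s hs ↦ hf.bound _ (hγC s hs) _ _) ht
  exact sqrt_mul_le_of_abs_deriv_le
    (h := fun t ↦ hess nabla f (γ t) (velocity γ (Icc 0 1) t) (velocity γ (Icc 0 1) t))
    (fun s hs ↦ hf.hess_nonneg (hγC s hs) _)
    (fun s hs ↦ hγ.hasDerivWithinAt_hess hf hγC hγ.parallel hγ.parallel hs) hf.nonneg
    (fun s hs ↦ hf.bound _ (hγC s hs) _ _) hs

/-- The transports of `∇` and `∇*` are adjoint with respect to the Hessian metric. -/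
theorem IsGeodesic.hess_dual_transport (hγ : IsGeodesic nabla γ 0 1)
    (hf : IsSelfConcordant nabla C f σ) (hγC : ∀ t ∈ Icc (0 : ℝ) 1, γ t ∈ C)
    {V W : ∀ t, TangentSpace 𝓘(ℝ, E) (γ t)}
    (hV : IsParallelAlong (dualConnection nabla f) γ (Icc 0 1) V)
    (hW : IsParallelAlong nabla γ (Icc 0 1) W) {t : ℝ} (ht : t ∈ Icc (0 : ℝ) 1) :
    hess nabla f (γ t) (V t) (W t) = hess nabla f (γ 0) (V 0) (W 0) := by
  have hd : ∀ s ∈ Icc (0 : ℝ) 1, HasDerivWithinAt (fun t ↦ hess nabla f (γ t) (V t) (W t)) 0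
      (Icc 0 1) s := fun s hs ↦
    hasDerivWithinAt_hess_dual_parallel nabla hs (uniqueDiffOn_Icc_zero_one s hs)
      ((hγ.smooth s hs).mdifferentiableWithinAt (by simp))
      (hf.eventually_contMDiffAt (hγC s hs)) (hf.nondegenerate _ (hγC s hs)) hV hW
  exact constant_of_derivWithin_zero (f := fun t ↦ hess nabla f (γ t) (V t) (W t))
    (fun s hs ↦ (hd s hs).differentiableWithinAt)
    (fun s hs ↦ (hd s (Ico_subset_Icc_self hs)).derivWithin
      (uniqueDiffOn_Icc_zero_one s (Ico_subset_Icc_self hs))) t ht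

end Transport

end InfoGeom

/-! ### Eigenvalue and norm bounds -/

open InfoGeom in
theorem mainTheorem11
    {E : Type*} [NormedAddCommGroup E] [NormedSpace ℝ E] [FiniteDimensional ℝ E]
    {M : Type*} [TopologicalSpace M] [T2Space M] [SecondCountableTopology M]
    [ChartedSpace E M] [IsManifold 𝓘(ℝ, E) ∞ M]
    (nabla : CovariantDerivative 𝓘(ℝ, E) E (TangentSpace 𝓘(ℝ, E) : M → Type _))
    [CovariantDerivative.ContMDiffCovariantDerivative nabla ∞]
    (htors : InfoGeom.IsTorsionFree nabla)
    (hexp : InfoGeom.HasSurjectiveExp nabla)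
    (C : Set M) (f : M → ℝ) (σ : ℝ)
    (hf : InfoGeom.IsSelfConcordant nabla C f σ)
    (γ : ℝ → M) (hγ : InfoGeom.IsGeodesic nabla γ 0 1) (hγC : ∀ t ∈ Icc (0 : ℝ) 1, γ t ∈ C)
    (r : ℝ) (hr : r = InfoGeom.localNorm nabla f (γ 0) (InfoGeom.velocity γ (Icc 0 1) 0))
    (hσr : σ * r < 1)
    (τ δ : ∀ t : ℝ, TangentSpace 𝓘(ℝ, E) (γ 0) ≃L[ℝ] TangentSpace 𝓘(ℝ, E) (γ t))
    (hτ : InfoGeom.IsParallelTransport nabla γ τ)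
    (hδ : InfoGeom.IsParallelTransport (InfoGeom.dualConnection nabla f) γ δ) :
    (∀ μ : ℝ,
      Module.End.HasEigenvalue (InfoGeom.returnTransport τ δ 1).toLinearMap μ →
        (1 - σ * r) ^ 2 ≤ μ ∧ μ ≤ 1 / (1 - σ * r) ^ 2) ∧
    (IntervalIntegrable (InfoGeom.endCurve (InfoGeom.returnTransport τ δ))
        MeasureTheory.volume 0 1 ∧
      ∀ μ : ℝ,
        Module.End.HasEigenvalue
            (InfoGeom.endIntegral (InfoGeom.returnTransport τ δ)).toLinearMap μ →
          1 - σ * r + 1 / 3 * σ ^ 2 * r ^ 2 ≤ μ ∧ μ ≤ 1 / (1 - σ * r)) ∧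
    (∀ v : TangentSpace 𝓘(ℝ, E) (γ 1), v ≠ 0 →
      1 - σ * r ≤ InfoGeom.localNorm nabla f (γ 1) v /
          InfoGeom.localNorm nabla f (γ 0) ((δ 1).symm v) ∧
      InfoGeom.localNorm nabla f (γ 1) v /
          InfoGeom.localNorm nabla f (γ 0) ((δ 1).symm v) ≤ 1 / (1 - σ * r)) := by
  have h0 : (0 : ℝ) ∈ Icc (0 : ℝ) 1 := left_mem_Icc.2 zero_le_one
  have h1 : (1 : ℝ) ∈ Icc (0 : ℝ) 1 := right_mem_Icc.2 zero_le_one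
  have hr0 : 0 ≤ r := hr ▸ Real.sqrt_nonneg _
  have hc0 : 0 ≤ σ * r := mul_nonneg hf.nonneg hr0
  have hp : 0 < 1 - σ * r := by linarith
  have hcomp : ∀ t ∈ Icc (0 : ℝ) 1, ∀ u : TangentSpace 𝓘(ℝ, E) (γ 0),
      (1 - σ * r * t) ^ 2 * hess nabla f (γ 0) u u ≤ hess nabla f (γ t) (τ t u) (τ t u) ∧
      hess nabla f (γ t) (τ t u) (τ t u) ≤
        1 / (1 - σ * r * t) ^ 2 * hess nabla f (γ 0) u u := by
    subst hr
    intro t ht u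
    have h := hγ.hess_comparison hf hγC hσr (hτ.parallel u) ht
    simpa only [hτ.map_zero] using h
  have hpair : ∀ t ∈ Icc (0 : ℝ) 1, ∀ z u : TangentSpace 𝓘(ℝ, E) (γ 0),
      hess nabla f (γ t) (δ t z) (τ t u) = hess nabla f (γ 0) z u := by
    intro t ht z u
    have h := hγ.hess_dual_transport hf hγC (hδ.parallel z) (hτ.parallel u) ht
    simpa only [hτ.map_zero, hδ.map_zero] using h
  -- Adjointness with `z = δ_t⁻¹ τ_t u`: the return transport represents the pulled-back metric.
  have hret : ∀ t ∈ Icc (0 : ℝ) 1, ∀ u v : TangentSpace 𝓘(ℝ, E) (γ 0),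
      hess nabla f (γ 0) (returnTransport τ δ t u) v = hess nabla f (γ t) (τ t u) (τ t v) := by
    intro t ht u v
    rw [← hpair t ht, show δ t (returnTransport τ δ t u) = τ t u from
      (δ t).apply_symm_apply (τ t u)]
  let B : E →ₗ[ℝ] E →ₗ[ℝ] ℝ :=
    hessBilin nabla (hf.eventually_contMDiffAt (hγC 0 h0)).self_of_nhds
  have hpos : ∀ v : E, v ≠ 0 → 0 < B v v := hf.nondegenerate _ (hγC 0 h0)
  have hB : Function.Injective B := by
    rw [injective_iff_map_eq_zero]
    intro a ha
    by_contra hne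
    exact (hpos a hne).ne' (congrArg (fun L ↦ L a) ha)
  have hretB : ∀ t ∈ Icc (0 : ℝ) 1, ∀ u v : E,
      B (endCurve (returnTransport τ δ) t u) v = hess nabla f (γ t) (τ t u) (τ t v) := hret
  have hcompB : ∀ t ∈ Icc (0 : ℝ) 1, ∀ v : E,
      (1 - σ * r * t) ^ 2 * B v v ≤ B (endCurve (returnTransport τ δ) t v) v ∧
      B (endCurve (returnTransport τ δ) t v) v ≤ 1 / (1 - σ * r * t) ^ 2 * B v v := fun t ht v ↦
    ⟨(hcomp t ht v).1.trans_eq (hretB t ht v v).symm,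
      (hretB t ht v v).trans_le (hcomp t ht v).2⟩
  have hcont : ∀ u v : E, ContinuousOn (fun t ↦ B (endCurve (returnTransport τ δ) t u) v)
      (Icc 0 1) := fun u v ↦
    ContinuousOn.congr (f := fun t ↦ hess nabla f (γ t) (τ t u) (τ t v))
      (fun t ht ↦ (hγ.hasDerivWithinAt_hess hf hγC (hτ.parallel u) (hτ.parallel v)
        ht).continuousWithinAt) (fun t ht ↦ hretB t ht u v)
  have hint : IntervalIntegrable (endCurve (returnTransport τ δ)) MeasureTheory.volume 0 1 :=
    (continuousOn_clm_of_bilin hB hcont).intervalIntegrable_of_Icc zero_le_one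
  refine ⟨fun μ hμ ↦ ?_, ⟨hint, fun μ hμ ↦ ?_⟩, fun v hv ↦ ?_⟩
  · obtain ⟨v, hv, hv0⟩ : ∃ v : E, endCurve (returnTransport τ δ) 1 v = μ • v ∧ v ≠ 0 :=
      hμ.exists_hasEigenvector.imp fun v hv ↦ ⟨hv.apply_eq_smul, hv.2⟩
    have h := hcompB 1 h1 v
    rw [hv, map_smul, LinearMap.smul_apply, smul_eq_mul, mul_one] at h
    exact ⟨le_of_mul_le_mul_right h.1 (hpos v hv0), le_of_mul_le_mul_right h.2 (hpos v hv0)⟩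
  · obtain ⟨v, hv, hv0⟩ : ∃ v : E,
        (∫ t in (0 : ℝ)..1, endCurve (returnTransport τ δ) t) v = μ • v ∧ v ≠ 0 :=
      hμ.exists_hasEigenvector.imp fun v hv ↦ ⟨hv.apply_eq_smul, hv.2⟩
    have hvv := hpos v hv0
    -- On an eigenvector of the mean, `μ` times the squared norm is the integral of the pointwise
    -- quadratic forms, to which the bounds of `hcompB` apply.
    have hAv : ∫ t in (0 : ℝ)..1, B (endCurve (returnTransport τ δ) t v) v = μ * B v v := by
      rw [← bilin_intervalIntegral_apply B hint, hv, map_smul, LinearMap.smul_apply, smul_eq_mul]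
    have hAi := (hcont v v).intervalIntegrable_of_Icc (μ := MeasureTheory.volume) zero_le_one
    have hl := intervalIntegral.integral_mono_on (μ := MeasureTheory.volume) zero_le_one
      (Continuous.intervalIntegrable (u := fun t ↦ (1 - σ * r * t) ^ 2 * B v v) (by fun_prop) 0 1)
      hAi (fun t ht ↦ (hcompB t ht v).1)
    have hu := intervalIntegral.integral_mono_on (μ := MeasureTheory.volume) zero_le_one hAi
      ((intervalIntegrable_one_div_one_sub_mul_sq hc0 hσr).mul_const (B v v))
      (fun t ht ↦ (hcompB t ht v).2)
    rw [hAv, intervalIntegral.integral_mul_const] at hl hu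
    rw [integral_one_sub_mul_sq] at hl
    rw [integral_one_div_one_sub_mul_sq hc0 hσr] at hu
    refine ⟨?_, le_of_mul_le_mul_right hu hvv⟩
    have := le_of_mul_le_mul_right hl hvv
    linarith
  · obtain ⟨w, rfl⟩ := (δ 1).surjective v
    obtain ⟨u, hu⟩ := (τ 1).surjective (δ 1 w)
    rw [(δ 1).symm_apply_apply]
    have hw : w ≠ 0 := by
      rintro rfl
      exact hv (map_zero _)
    have hsq : ∀ t ∈ Icc (0 : ℝ) 1, ∀ a : TangentSpace 𝓘(ℝ, E) (γ t),
        hess nabla f (γ t) a a = localNorm nabla f (γ t) a ^ 2 := fun t ht a ↦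
      (Real.sq_sqrt (hf.hess_nonneg (hγC t ht) a)).symm
    have hnn : ∀ t (a : TangentSpace 𝓘(ℝ, E) (γ t)), 0 ≤ localNorm nabla f (γ t) a :=
      fun t a ↦ Real.sqrt_nonneg _
    have hN0 : 0 < localNorm nabla f (γ 0) w :=
      Real.sqrt_pos.2 (hf.nondegenerate _ (hγC 0 h0) w hw)
    have hN1 : 0 < localNorm nabla f (γ 1) (δ 1 w) :=
      Real.sqrt_pos.2 (hf.nondegenerate _ (hγC 1 h1) _ hv)
    constructor
    -- `‖w‖₀² = ⟨δw, τw⟩₁ ≤ ‖δw‖₁ ‖τw‖₁ ≤ ‖δw‖₁ ‖w‖₀ / (1 - σr)`.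
    · rw [le_div_iff₀ hN0]
      have e1 := hf.hess_le_localNorm_mul htors (hγC 1 h1) (δ 1 w) (τ 1 w)
      rw [hpair 1 h1, hsq 0 h0] at e1
      have e2 := (hcomp 1 h1 w).2
      rw [hsq 0 h0, hsq 1 h1, mul_one, one_div_mul_eq_div, ← div_pow,
        pow_le_pow_iff_left₀ (hnn _ _) (div_nonneg (hnn _ _) hp.le) two_ne_zero,
        le_div_iff₀ hp] at e2
      have e3 := mul_le_mul_of_nonneg_left e2 hN1.le
      have e4 := mul_le_mul_of_nonneg_right e1 hp.le
      refine le_of_mul_le_mul_right ?_ hN0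
      linarith
    -- With `τu = δw`: `‖δw‖₁² = ⟨w, u⟩₀ ≤ ‖w‖₀ ‖u‖₀ ≤ ‖w‖₀ ‖δw‖₁ / (1 - σr)`.
    · rw [div_le_div_iff₀ hN0 hp, one_mul]
      have e1 := hf.hess_le_localNorm_mul htors (hγC 0 h0) w u
      rw [← hpair 1 h1, hu, hsq 1 h1] at e1
      have e2 := (hcomp 1 h1 u).1
      rw [hsq 0 h0, hu, hsq 1 h1, mul_one, ← mul_pow,
        pow_le_pow_iff_left₀ (mul_nonneg hp.le (hnn _ _)) (hnn _ _) two_ne_zero] at e2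
      have e3 := mul_le_mul_of_nonneg_left e2 hN0.le
      have e4 := mul_le_mul_of_nonneg_right e1 hp.le
      refine le_of_mul_le_mul_right ?_ hN1
      linarith
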